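/- Let $\mathcal X\subseteq\mathbb R^d$ be a measurable set of finite Lebesgue measure and $\mathcal Y\subset\mathbb R$ a bounded measurable set. Let $(\mathbf X_1,Y_1),(\mathbf X_2,Y_2),\dots$ be independent copies of a random pair $(\mathbf X,Y)$ with values in $\mathcal X\times\mathcal Y$ such that $Y$ has a conditional density $f_{Y\mid\mathbf X}(y\mid\mathbf x)$ given $\mathbf X=\mathbf x$ and, for almost every $y\in\mathcal Y$, the map $\mathbf x\mapsto f_{Y\mid\mathbf X}(y\mid\mathbf x)$ is uniformly continuous on $\mathcal X$. For each $n\in\mathbb N$, the full data set $\{(\mathbf X_i,Y_i)\}_{i=1}^{N}$ of size $N=N(n)$ is reduced to representative points of nominal size $n$ as follows. The range of each coordinate of $\mathcal X$ is divided into $\kappa(n)$ disjoint intervals, which gives a (nonrandom) partition of $\mathcal X$ into $K(n)=\kappa(n)^d$ cells $B_1,\dots,B_{K(n)}$. Let $N_k$ be the number of $i\le N$ with $\mathbf X_i\in B_k$. To the cell $B_k$ one allocates $n_k$ points, where $n_k$ is the proportional share $nN_k/N$ up to rounding, $|n_k-nN_k/N|\le 1$. The conditional support points $y^{*(k)}_1,\dots,y^{*(k)}_{n_k}$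 in $B_k$ are any minimizer over $z\in\mathbb R^{n_k}$ of $$\frac{2}{n_kN_k}\sum_{j=1}^{n_k}\sum_{i=1}^{N}|z_j-Y_i|\,1(\mathbf X_i\in B_k)-\frac1{n_k^2}\sum_{i=1}^{n_k}\sum_{j=1}^{n_k}|z_i-z_j| .$$ For $\mathbf x\in\mathcal X$ let $B_{\mathbf x}$ be the cell that contains $\mathbf x$. Denote by $\phi_{n,Y\mid\mathbf X}(s\mid B_{\mathbf x})=n_k^{-1}\sum_{j=1}^{n_k}\exp(\mathrm i s y_j^{*(k)})$, with $B_k=B_{\mathbf x}$, the empirical characteristic function of the conditional support points in this cell, and by $\phi_{Y\mid\mathbf X}(s\mid B_{\mathbf x})$ the characteristic function of $Y$ given $\mathbf X\in B_{\mathbf x}$. Assume that the full data set is larger than the reduced one by at least a logarithmic factor, $n\log n=O(N(n))$, that $K(n)\to\infty$ as $n\to\infty$, and that the number of points in each cell tends to infinity, that is, for every $\mathbf x\in\mathcal X$, almost surely, the number $n_k$ for the cell $B_k=B_{\mathbf x}$ tends to infinity. Then, for every $\mathbf x\in\mathcal X$, almost surely, $$\phi_{n,Y\mid\mathbf X}(s\mid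 B_{\mathbf x})-\phi_{Y\mid\mathbf X}(s\mid B_{\mathbf x})\longrightarrow 0\qquad\text{as } n\to\infty,\ \text{for all } s\in\mathbb R .$$ -/

import Mathlib

open MeasureTheory ProbabilityTheory Filter Topology Asymptotics

/-- A binning partition of `𝒳 ⊆ ℝ^d`: the range of each coordinate is divided into `κ` disjoint
intervals. The `κ ^ d` cells are the resulting boxes, intersected with `𝒳`. -/
structure GridPartition {d : ℕ} (𝒳 : Set (EuclideanSpace ℝ (Fin d))) (κ : ℕ) where
  /-- the `j`-th interval of the `q`-th coordinate -/
  interval : Fin d → Fin κ → Set ℝ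
  ordConnected : ∀ q j, (interval q j).OrdConnected
  nonempty : ∀ q j, (interval q j).Nonempty
  disjoint : ∀ q j j', j ≠ j' → Disjoint (interval q j) (interval q j')
  cover : ∀ x ∈ 𝒳, ∀ q, ∃ j, x q ∈ interval q j

namespace GridPartition

variable {d : ℕ} {𝒳 : Set (EuclideanSpace ℝ (Fin d))} {κ : ℕ}

/-- The cell with multi-index `k`; there are `κ ^ d` multi-indices. -/
def cell (G : GridPartition 𝒳 κ) (k : Fin d → Fin κ) : Set (EuclideanSpace ℝ (Fin d)) :=
  {x | x ∈ 𝒳 ∧ ∀ q, x q ∈ G.interval q (k q)}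

/-- The multi-index of the cell `B_x` that contains the point `x ∈ 𝒳`. -/
noncomputable def index (G : GridPartition 𝒳 κ) (x : 𝒳) : Fin d → Fin κ :=
  fun q => (G.cover x.1 x.2 q).choose

theorem mem_cell_index (G : GridPartition 𝒳 κ) (x : 𝒳) : x.1 ∈ G.cell (G.index x) :=
  ⟨x.2, fun q => (G.cover x.1 x.2 q).choose_spec⟩

theorem eq_index_of_mem_cell (G : GridPartition 𝒳 κ) (x : 𝒳) (k : Fin d → Fin κ)
    (h : x.1 ∈ G.cell k) : k = G.index x := by
  funext q
  by_contra hne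
  exact Set.disjoint_left.1 (G.disjoint q _ _ hne) (h.2 q) ((G.mem_cell_index x).2 q)

end GridPartition

/-- The number of the first `N` covariates that lie in `B`. -/
noncomputable def cellCount {E : Type*} (N : ℕ) (x : ℕ → E) (B : Set E) : ℕ :=
  ∑ i ∈ Finset.range N, B.indicator 1 (x i)

/-- The Monte Carlo energy criterion of the `m` points `z` for the cell `B`, computed from the data
`(x i, y i)`, `i < N`. -/
noncomputable def cellEnergy {E : Type*} (N : ℕ) (x : ℕ → E) (y : ℕ → ℝ) (B : Set E) {m : ℕ}
    (z : Fin m → ℝ) : ℝ :=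
  2 / ((m : ℝ) * (cellCount N x B : ℝ)) *
      ∑ j, ∑ i ∈ Finset.range N, |z j - y i| * B.indicator 1 (x i)
    - 1 / (m : ℝ) ^ 2 * ∑ i, ∑ j, |z i - z j|

/-- `z` is a set of `m` conditional support points in the cell `B` for the data `(x i, y i)`,
`i < N`: a global minimizer over `ℝ^m` of the energy criterion of the cell. -/
def IsCondSupportPoints {E : Type*} (N : ℕ) (x : ℕ → E) (y : ℕ → ℝ) (B : Set E) {m : ℕ}
    (z : Fin m → ℝ) : Prop :=
  ∀ z' : Fin m → ℝ, cellEnergy N x y B z ≤ cellEnergy N x y B z'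

/-- The empirical characteristic function `s ↦ m⁻¹ ∑ j, exp(i s z_j)` of `m` points. -/
noncomputable def empiricalCharFun {m : ℕ} (z : Fin m → ℝ) (s : ℝ) : ℂ :=
  (1 / (m : ℂ)) * ∑ j, Complex.exp (Complex.I * (s : ℂ) * (z j : ℂ))

/-- `f x y = f_{Y ∣ X}(y ∣ x)` is a version of the conditional density of `V` given `U`: the joint
law of `(U, V)` is `f_{Y ∣ X}(y ∣ x) dy P_U(dx)`. -/
structure IsCondDensity {Ω E : Type*} [MeasurableSpace Ω] [MeasurableSpace E] (P : Measure Ω)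
    (U : Ω → E) (V : Ω → ℝ) (f : E → ℝ → ℝ) : Prop where
  measurable : Measurable (Function.uncurry f)
  nonneg : ∀ x y, 0 ≤ f x y
  map_eq : P.map (fun ω => (U ω, V ω)) =
    ((P.map U).prod volume).withDensity (fun p => ENNReal.ofReal (f p.1 p.2))

/-- The characteristic function of `V` given the event `U ∈ B`. -/
noncomputable def condCharFun {Ω E : Type*} [MeasurableSpace Ω] (P : Measure Ω)
    (U : Ω → E) (V : Ω → ℝ) (B : Set E) (s : ℝ) : ℂ :=
  charFun ((P[|U ⁻¹' B]).map V) s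

/-!
The difference of the two characteristic functions is split at the empirical characteristic function
of the responses in the cell (`cellCharFun`).

*From the support points to the data.* This part is deterministic. The energy criterion is, up to a
constant, the energy distance between the support points and the data in the cell. The first-order
condition `le_of_forall_energy_le` for a minimizer with `m` points, on moving one point at a time,
shows that all points stay in the range `[-M, M]` of the data, and that the energy distance is at
most `2 * M / m`. On the line the energy distance is `2 ∫ D²`, where `D` is the difference of the
distribution functions (`integral_sq_sum_mul_indicator`), and the difference of the characteristic
functions at `s` is, up to a unimodular factor, `s ∫ exp(i s t) D(t) dt`
(`sum_mul_cexp_eq_integral`). As `D` lives on `[-M, M]`, this is of order `|s| * M / √m`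
(`IsCondSupportPoints.norm_empiricalCharFun_sub_le`).

*From the data to the law.* Since `m` is proportional to the number of data in the cell and tends to
infinity, and `n log n = O(N n)`, that number exceeds every multiple of `log n`
(`eventually_mul_log_le_of_proportional`). The Chernoff bound `measure_le_cellCount_le` is
normalized by the random number of data in the cell, so it holds without any lower bound on the
probability of the cell, and its error terms are summable. The Borel–Cantelli lemma gives almost
sure convergence at each frequency `s` (`ae_tendsto_cellCharFun_sub_condCharFun`). Bounded responses
make the characteristic functions Lipschitz in `s` uniformly in `n`, which carries the convergence
from the rational frequencies to all of them on one event of full probability.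
-/

/-! ### Energy distance and characteristic functions -/

/-- The energy of a signed measure of mass zero on `[-M, M]` is twice the squared `L²` norm of its
tail function `t ↦ ∑ i, w i * 1(t ≤ p i)`. -/
theorem integral_sq_sum_mul_indicator {ι : Type*} [Fintype ι] {w p : ι → ℝ} {M : ℝ}
    (hw : ∑ i, w i = 0) (hp : ∀ i, |p i| ≤ M) :
    ∫ t in (-M)..M, (∑ i, w i * {t | t ≤ p i}.indicator 1 t) ^ 2
      = -(1 / 2) * ∑ i, ∑ j, w i * w j * |p i - p j| := by
  have hint : ∀ a : ℝ,
      IntervalIntegrable ({t : ℝ | t ≤ a}.indicator (1 : ℝ → ℝ)) volume (-M) M := by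
    intro a
    exact ⟨(integrable_const (1 : ℝ)).indicator measurableSet_Iic,
      (integrable_const (1 : ℝ)).indicator measurableSet_Iic⟩
  have hsq : ∀ t, (∑ i, w i * {t | t ≤ p i}.indicator (1 : ℝ → ℝ) t) ^ 2
      = ∑ i, ∑ j, w i * w j * {t | t ≤ min (p i) (p j)}.indicator (1 : ℝ → ℝ) t := by
    intro t
    rw [sq, Finset.sum_mul_sum]
    refine Finset.sum_congr rfl fun i _ => Finset.sum_congr rfl fun j _ => ?_
    by_cases h1 : t ≤ p i <;> by_cases h2 : t ≤ p j <;> simp [h1, h2]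
  have hmin : ∀ i j, ∫ t in (-M)..M, {t | t ≤ min (p i) (p j)}.indicator (1 : ℝ → ℝ) t
      = min (p i) (p j) + M := by
    intro i j
    have hi := abs_le.1 (hp i)
    have hj := abs_le.1 (hp j)
    rw [intervalIntegral.integral_indicator ⟨le_min hi.1 hj.1, (min_le_left _ _).trans hi.2⟩]
    simp
  have hint' : ∀ i, IntervalIntegrable
      (fun t => ∑ j, w i * w j * {t | t ≤ min (p i) (p j)}.indicator (1 : ℝ → ℝ) t)
      volume (-M) M := by
    intro i
    have h := IntervalIntegrable.sum Finset.univ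
      fun j _ => (hint (min (p i) (p j))).const_mul (w i * w j)
    rwa [Finset.sum_fn] at h
  simp_rw [hsq]
  rw [intervalIntegral.integral_finsetSum fun i _ => hint' i]
  simp_rw [intervalIntegral.integral_finsetSum fun j _ => (hint (min (p _) (p j))).const_mul _,
    intervalIntegral.integral_const_mul, hmin, Finset.mul_sum]
  -- `min a b + M` differs from `-|a - b| / 2` by a sum of functions of one variable
  have h0 : ∑ i, ∑ j, w i * w j * ((p i + p j) / 2 + M) = 0 := by
    have h1 : ∀ i, ∑ j, w i * w j * ((p i + p j) / 2 + M)
        = w i * (∑ j, w j * (p j / 2)) + w i * (p i / 2 + M) * ∑ j, w j := by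
      intro i
      rw [Finset.mul_sum, Finset.mul_sum, ← Finset.sum_add_distrib]
      exact Finset.sum_congr rfl fun j _ => by ring
    simp_rw [h1, hw, mul_zero, add_zero]
    rw [← Finset.sum_mul, hw, zero_mul]
  rw [← sub_zero (∑ i, ∑ j, w i * w j * (min (p i) (p j) + M)), ← h0]
  simp_rw [← Finset.sum_sub_distrib]
  refine Finset.sum_congr rfl fun i _ => Finset.sum_congr rfl fun j _ => ?_
  rcases le_total (p i) (p j) with h | h
  · rw [min_eq_left h, abs_of_nonpos (by linarith)]; ring
  · rw [min_eq_right h, abs_of_nonneg (by linarith)]; ring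

/-- Integration by parts: the Fourier transform of a signed measure of mass zero on `[-M, M]` in
terms of its tail function. -/
theorem sum_mul_cexp_eq_integral {ι : Type*} [Fintype ι] {w p : ι → ℝ} {M : ℝ}
    (hw : ∑ i, w i = 0) (hp : ∀ i, |p i| ≤ M) (s : ℝ) :
    ∑ i, (w i : ℂ) * Complex.exp (Complex.I * s * p i)
      = ∫ t in (-M)..M, ((∑ i, w i * {t | t ≤ p i}.indicator 1 t : ℝ) : ℂ)
          * (Complex.I * s * Complex.exp (Complex.I * s * t)) := by
  set g : ℝ → ℂ := fun t => Complex.exp (Complex.I * s * t)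
  set g' : ℝ → ℂ := fun t => Complex.I * s * Complex.exp (Complex.I * s * t)
  have hg : ∀ t, HasDerivAt g (g' t) t := by
    intro t
    have h := (((hasDerivAt_id t).ofReal_comp).const_mul (Complex.I * (s : ℂ))).cexp
    simpa [g, g', mul_comm] using h
  have hcont : Continuous g' := by fun_prop
  have hint : ∀ a : ℝ, IntervalIntegrable ({t : ℝ | t ≤ a}.indicator g') volume (-M) M := by
    intro a
    have h := hcont.intervalIntegrable (μ := volume) (-M) M
    exact ⟨h.1.indicator measurableSet_Iic, h.2.indicator measurableSet_Iic⟩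
  have hrew : ∀ t, ((∑ i, w i * {t | t ≤ p i}.indicator (1 : ℝ → ℝ) t : ℝ) : ℂ) * g' t
      = ∑ i, (w i : ℂ) * {t | t ≤ p i}.indicator g' t := by
    intro t
    push_cast
    rw [Finset.sum_mul]
    refine Finset.sum_congr rfl fun i _ => ?_
    by_cases h : t ≤ p i <;> simp [h]
  have hi : ∀ i, ∫ t in (-M)..M, {t | t ≤ p i}.indicator g' t = g (p i) - g (-M) := by
    intro i
    have h := abs_le.1 (hp i)
    rw [intervalIntegral.integral_indicator ⟨h.1, h.2⟩]
    exact intervalIntegral.integral_eq_sub_of_hasDerivAt (fun t _ => hg t)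
      (hcont.intervalIntegrable _ _)
  refine Eq.trans ?_ (intervalIntegral.integral_congr fun t _ => hrew t).symm
  rw [intervalIntegral.integral_finsetSum fun i _ => (hint _).const_mul _]
  simp_rw [intervalIntegral.integral_const_mul, hi, mul_sub]
  rw [Finset.sum_sub_distrib, ← Finset.sum_mul, ← Complex.ofReal_sum, hw]
  simp [g]

/-- A signed measure of mass zero on `[-M, M]` with small energy has a small Fourier transform. -/
theorem norm_sum_mul_cexp_le {ι : Type*} [Fintype ι] {w p : ι → ℝ} {M : ℝ}
    (hM : 0 ≤ M) (hw : ∑ i, w i = 0) (hp : ∀ i, |p i| ≤ M) (s : ℝ) {δ : ℝ} (hδ : 0 < δ) :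
    ‖∑ i, (w i : ℂ) * Complex.exp (Complex.I * s * p i)‖
      ≤ |s| * (M * δ + 1 / (2 * δ) * (-(1 / 2) * ∑ i, ∑ j, w i * w j * |p i - p j|)) := by
  rw [sum_mul_cexp_eq_integral hw hp, ← integral_sq_sum_mul_indicator hw hp]
  set D : ℝ → ℝ := fun t => ∑ i, w i * {t | t ≤ p i}.indicator 1 t
  have hDm : Measurable D := by
    refine Finset.measurable_sum _ fun i _ => ?_
    exact (measurable_one.indicator measurableSet_Iic).const_mul _
  have hDb : ∀ t, |D t| ≤ ∑ i, |w i| := by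
    intro t
    refine (Finset.abs_sum_le_sum_abs _ _).trans (Finset.sum_le_sum fun i _ => ?_)
    by_cases h : t ≤ p i <;> simp [h]
  have hD2 : IntervalIntegrable (fun t => D t ^ 2) volume (-M) M := by
    have hb : ∀ t, ‖D t ^ 2‖ ≤ (∑ i, |w i|) ^ 2 := fun t => by
      rw [norm_pow, Real.norm_eq_abs]
      exact pow_le_pow_left₀ (abs_nonneg _) (hDb t) 2
    exact ⟨Integrable.of_bound (hDm.pow_const 2).aestronglyMeasurable _ (ae_of_all _ hb),
      Integrable.of_bound (hDm.pow_const 2).aestronglyMeasurable _ (ae_of_all _ hb)⟩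
  -- a weighted arithmetic-geometric mean inequality takes the place of Cauchy–Schwarz
  have hle : ∀ t, ‖(D t : ℂ) * (Complex.I * s * Complex.exp (Complex.I * s * t))‖
      ≤ |s| * (δ / 2 + 1 / (2 * δ) * D t ^ 2) := by
    intro t
    have he : ‖Complex.exp (Complex.I * s * t)‖ = 1 := by
      rw [mul_assoc, mul_comm, ← Complex.ofReal_mul, Complex.norm_exp_ofReal_mul_I]
    rw [norm_mul, norm_mul, norm_mul, he, Complex.norm_I, Complex.norm_real, Complex.norm_real,
      one_mul, mul_one, Real.norm_eq_abs, Real.norm_eq_abs, mul_comm]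
    refine mul_le_mul_of_nonneg_left ?_ (abs_nonneg s)
    have h : δ / 2 + 1 / (2 * δ) * D t ^ 2 - |D t| = 1 / (2 * δ) * (δ - |D t|) ^ 2 := by
      rw [← sq_abs (D t)]; field_simp; ring
    have : 0 ≤ 1 / (2 * δ) * (δ - |D t|) ^ 2 := by positivity
    linarith
  refine (intervalIntegral.norm_integral_le_of_norm_le (by linarith) (ae_of_all _ fun t _ => hle t)
    ((intervalIntegrable_const.add (hD2.const_mul _)).const_mul _)).trans (le_of_eq ?_)
  rw [intervalIntegral.integral_const_mul, intervalIntegral.integral_add intervalIntegrable_const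
    (hD2.const_mul _), intervalIntegral.integral_const_mul, intervalIntegral.integral_const]
  congr 2
  rw [smul_eq_mul]; ring

/-! ### Minimizers of the energy criterion -/

/-- First-order condition for a minimizer of an energy with external potential `V`: moving the
single point `z j` to any `a` does not decrease the energy. -/
theorem le_of_forall_energy_le {m : ℕ} {V : ℝ → ℝ} {z : Fin m → ℝ}
    (hz : ∀ z' : Fin m → ℝ, 2 / (m : ℝ) * ∑ j, V (z j) - 1 / (m : ℝ) ^ 2 * ∑ i, ∑ j, |z i - z j|
      ≤ 2 / (m : ℝ) * ∑ j, V (z' j) - 1 / (m : ℝ) ^ 2 * ∑ i, ∑ j, |z' i - z' j|)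
    (j : Fin m) (a : ℝ) :
    m * V (z j) - ∑ k, |z j - z k| ≤ m * V a - ∑ k, |a - z k| + |a - z j| := by
  have hm : (0 : ℝ) < m := by exact_mod_cast j.pos
  have hupd : ∀ g : ℝ → ℝ, ∑ k, g (Function.update z j a k) = ∑ k, g (z k) + g a - g (z j) := by
    intro g
    have h : ∀ k, g (Function.update z j a k) = g (z k) + if k = j then g a - g (z j) else 0 := by
      intro k
      by_cases hk : k = j
      · subst hk; simp
      · simp [hk]
    simp_rw [h, Finset.sum_add_distrib]
    simp [add_sub_assoc]
  have h := hz (Function.update z j a)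
  have h2 : ∑ i, ∑ k, |Function.update z j a i - Function.update z j a k|
      = ∑ i, ∑ k, |z i - z k| + 2 * ∑ k, |a - z k| - 2 * ∑ k, |z j - z k| - 2 * |a - z j| := by
    have h1 : ∀ v, ∑ k, |v - Function.update z j a k|
        = ∑ k, |v - z k| + |v - a| - |v - z j| := fun v => hupd fun u => |v - u|
    simp_rw [h1]
    rw [hupd fun u => ∑ k, |u - z k| + |u - a| - |u - z j|]
    simp only [Finset.sum_add_distrib, Finset.sum_sub_distrib, sub_self, abs_zero]
    simp_rw [abs_sub_comm (z _) a, abs_sub_comm _ (z j)]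
    ring
  rw [h2, hupd V] at h
  have h3 := mul_le_mul_of_nonneg_left h (by positivity : 0 ≤ (m : ℝ) ^ 2 / 2)
  have e1 : ∀ S T : ℝ, (m : ℝ) ^ 2 / 2 * (2 / m * S - 1 / (m : ℝ) ^ 2 * T) = m * S - T / 2 := by
    intro S T; field_simp
  rw [e1, e1] at h3
  linarith

theorem cellCount_eq_card {E : Type*} (N : ℕ) (x : ℕ → E) (B : Set E) [DecidablePred (· ∈ B)] :
    cellCount N x B = ((Finset.range N).filter (x · ∈ B)).card := by
  rw [cellCount, Finset.card_filter]
  exact Finset.sum_congr rfl fun i _ => by simp [Set.indicator_apply]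

/-- The empirical characteristic function `s ↦ N_B⁻¹ ∑ exp(i s y_i)` of the `N_B` responses among
the first `N` data whose covariate lies in `B`. -/
noncomputable def cellCharFun {E : Type*} (N : ℕ) (x : ℕ → E) (y : ℕ → ℝ) (B : Set E) (s : ℝ) : ℂ :=
  (1 / (cellCount N x B : ℂ)) *
    ∑ i ∈ Finset.range N, B.indicator 1 (x i) * Complex.exp (Complex.I * s * y i)

namespace IsCondSupportPoints

variable {E : Type*} {N : ℕ} {x : ℕ → E} {y : ℕ → ℝ} {B : Set E} {m : ℕ} {z : Fin m → ℝ} {M : ℝ}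

/-- Support points reproduce the characteristic function of the responses in the cell. By the
first-order condition, a support point outside `[-M, M]` could be improved by moving it to the
nearest end point, and the energy distance to the data is at most `2 * M / m`, on comparing each
support point with the data in the average. -/
theorem norm_empiricalCharFun_sub_le (hz : IsCondSupportPoints N x y B z)
    (hM : ∀ i < N, x i ∈ B → |y i| ≤ M) (hm : 0 < m) (hc : 0 < cellCount N x B) (s : ℝ) :
    ‖empiricalCharFun z s - cellCharFun N x y B s‖ ≤ |s| * (3 / 2 * M / √m) := by
  classical
  set I := (Finset.range N).filter (x · ∈ B) with hI
  have hcard : cellCount N x B = I.card := cellCount_eq_card N x B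
  rw [hcard] at hc
  have hc' : (0 : ℝ) < I.card := by exact_mod_cast hc
  have hm' : (0 : ℝ) < m := by exact_mod_cast hm
  have hyM : ∀ i ∈ I, |y i| ≤ M := by
    intro i hi
    rw [hI, Finset.mem_filter, Finset.mem_range] at hi
    exact hM i hi.1 hi.2
  have hM0 : 0 ≤ M := by
    obtain ⟨i, hi⟩ := Finset.card_pos.1 hc
    exact (abs_nonneg _).trans (hyM i hi)
  set V : ℝ → ℝ := fun a => 1 / (I.card : ℝ) * ∑ i ∈ I, |a - y i| with hV
  have henergy : ∀ z : Fin m → ℝ, cellEnergy N x y B z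
      = 2 / (m : ℝ) * ∑ j, V (z j) - 1 / (m : ℝ) ^ 2 * ∑ i, ∑ j, |z i - z j| := by
    intro z
    rw [cellEnergy, hcard]
    congr 1
    simp_rw [hV]
    rw [← Finset.mul_sum, ← mul_assoc]
    congr 1
    · field_simp
    · refine Finset.sum_congr rfl fun j _ => ?_
      rw [hI, Finset.sum_filter]
      exact Finset.sum_congr rfl fun i _ => by by_cases h : x i ∈ B <;> simp [h]
  have hopt := le_of_forall_energy_le (V := V) (z := z) fun z' => by
    rw [← henergy, ← henergy]; exact hz z'
  -- the support points lie in `[-M, M]`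
  have hzM : ∀ j, |z j| ≤ M := by
    intro j
    set a := max (-M) (min M (z j)) with ha
    -- clipping shortens the distance to each datum by exactly `|z j - a|`
    have hadd : ∀ u, |u| ≤ M → |z j - u| = |a - u| + |z j - a| := by
      intro u hu
      obtain ⟨h1, h2⟩ := abs_le.1 hu
      rcases le_total M (z j) with h | h
      · have e : a = M := by rw [ha, min_eq_left h, max_eq_right (by linarith)]
        rw [e, abs_of_nonneg, abs_of_nonneg, abs_of_nonneg] <;> linarith
      · rcases le_total (-M) (z j) with h' | h'
        · have e : a = z j := by rw [ha, min_eq_right h, max_eq_right h']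
          simp [e]
        · have e : a = -M := by rw [ha, min_eq_right h, max_eq_left h']
          rw [e, abs_of_nonpos, abs_of_nonpos, abs_of_nonpos] <;> linarith
    have hVa : V (z j) = V a + |z j - a| := by
      simp_rw [hV]
      rw [Finset.sum_congr rfl fun i hi => hadd (y i) (hyM i hi), Finset.sum_add_distrib,
        Finset.sum_const, nsmul_eq_mul, mul_add]
      field_simp
    have h := hopt j a
    -- terms with `k ≠ j` contribute at most `|z j - a|` each, the term `k = j` exactly `-|z j - a|`
    have hk : ∑ k, |z j - z k| - ∑ k, |a - z k| ≤ (m - 2) * |z j - a| := by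
      rw [← Finset.sum_sub_distrib, ← Finset.add_sum_erase _ _ (Finset.mem_univ j)]
      have h1 : ∑ k ∈ Finset.univ.erase j, (|z j - z k| - |a - z k|)
          ≤ ∑ k ∈ Finset.univ.erase j, |z j - a| := by
        refine Finset.sum_le_sum fun k _ => ?_
        linarith [abs_sub_le (z j) a (z k)]
      rw [Finset.sum_const, Finset.card_erase_of_mem (Finset.mem_univ j), Finset.card_univ,
        Fintype.card_fin, nsmul_eq_mul, Nat.cast_sub hm, Nat.cast_one] at h1
      rw [sub_self, abs_zero, abs_sub_comm a (z j)]
      linarith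
    rw [hVa, abs_sub_comm a (z j)] at h
    have h0 : |z j - a| ≤ 0 := by linarith
    have h1 : z j = a := sub_eq_zero.1 (abs_nonpos_iff.1 h0)
    rw [h1, abs_le]
    exact ⟨le_max_left _ _, max_le (by linarith) (min_le_left _ _)⟩
  set A := ∑ j, V (z j) with hA
  set S := ∑ i, ∑ j, |z i - z j| with hS
  set W := 1 / (I.card : ℝ) * ∑ i ∈ I, V (y i) with hW
  -- average the first-order condition over the data and sum it over the support points
  have hED : (2 * m - 1) * A ≤ S + m ^ 2 * W := by
    have h1 : ∑ j, ∑ i ∈ I, (m * V (z j) - ∑ k, |z j - z k|)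
        ≤ ∑ j, ∑ i ∈ I, (m * V (y i) - ∑ k, |y i - z k| + |y i - z j|) :=
      Finset.sum_le_sum fun j _ => Finset.sum_le_sum fun i _ => hopt j (y i)
    have hzV : ∀ j, ∑ i ∈ I, |y i - z j| = I.card * V (z j) := by
      intro j
      simp_rw [hV, abs_sub_comm (z j)]
      field_simp
    have hWi : ∑ i ∈ I, V (y i) = I.card * W := by rw [hW]; field_simp
    simp only [Finset.sum_const, nsmul_eq_mul, Finset.sum_add_distrib, Finset.sum_sub_distrib,
      ← Finset.mul_sum, Finset.card_univ, Fintype.card_fin, hzV, hWi] at h1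
    rw [Finset.sum_comm (s := I)] at h1
    simp only [hzV, ← Finset.mul_sum] at h1
    rw [← hA, ← hS] at h1
    refine le_of_mul_le_mul_left ?_ hc'
    linarith
  have hA2 : A ≤ m * (2 * M) := by
    have h1 : ∀ j, V (z j) ≤ 2 * M := by
      intro j
      simp_rw [hV]
      have : ∑ i ∈ I, |z j - y i| ≤ ∑ i ∈ I, 2 * M := by
        refine Finset.sum_le_sum fun i hi => ?_
        linarith [abs_sub (z j) (y i), hzM j, hyM i hi]
      rw [Finset.sum_const, nsmul_eq_mul] at this
      rw [one_div, inv_mul_le_iff₀ hc']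
      exact this
    rw [hA]
    refine (Finset.sum_le_sum fun j _ => h1 j).trans (le_of_eq ?_)
    simp
  -- the signed measure: mass `1 / m` at support points, mass `-1 / N_B` at data in the cell
  let w : Fin m ⊕ I → ℝ := Sum.elim (fun _ => 1 / m) (fun _ => -(1 / I.card))
  let p : Fin m ⊕ I → ℝ := Sum.elim z (fun i => y i)
  have hw : ∑ i, w i = 0 := by
    simp [w, hm'.ne', hc'.ne']
  have hp : ∀ i, |p i| ≤ M := by
    rintro (j | i)
    · exact hzM j
    · exact hyM i i.2
  have hF : ∑ i, (w i : ℂ) * Complex.exp (Complex.I * s * p i)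
      = empiricalCharFun z s - cellCharFun N x y B s := by
    rw [Fintype.sum_sum_type, empiricalCharFun, cellCharFun, hcard, sub_eq_add_neg]
    congr 1
    · simp [w, p, Finset.mul_sum]
    · simp only [w, p, Sum.elim_inr]
      rw [Finset.sum_coe_sort I
        (fun i => ((-(1 / I.card : ℝ) : ℝ) : ℂ) * Complex.exp (Complex.I * s * y i)),
        ← Finset.mul_sum, hI, Finset.sum_filter, ← neg_mul]
      congr 1
      · push_cast; rfl
      · exact Finset.sum_congr rfl fun i _ => by by_cases h : x i ∈ B <;> simp [h]
  have hE : ∑ i, ∑ j, w i * w j * |p i - p j| = 1 / (m : ℝ) ^ 2 * S - 2 / m * A + W := by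
    simp only [Fintype.sum_sum_type, w, p, Sum.elim_inl, Sum.elim_inr]
    have e1 : ∀ u : ℝ, ∑ i : I, |u - y i| = I.card * V u := by
      intro u
      rw [Finset.sum_coe_sort I (fun i => |u - y i|), hV]
      field_simp
    have e2 : ∑ i : I, V (y i) = I.card * W := by
      rw [Finset.sum_coe_sort I (fun i => V (y i)), hW]
      field_simp
    have e3 : ∀ i : I, ∑ j, |y i - z j| = ∑ j, |z j - y i| := fun i =>
      Finset.sum_congr rfl fun j _ => abs_sub_comm _ _
    simp only [Finset.sum_add_distrib, ← Finset.mul_sum, e1, e2, e3]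
    rw [Finset.sum_comm (γ := I)]
    simp only [e1, ← Finset.mul_sum]
    rw [← hA, ← hS]
    field_simp
    ring
  have hsq : √(m : ℝ) ^ 2 = m := Real.sq_sqrt hm'.le
  have hs : 0 < √(m : ℝ) := Real.sqrt_pos.2 hm'
  -- this `δ` balances the two terms of the bound, as the energy is of order `1 / m`
  have h := norm_sum_mul_cexp_le hM0 hw hp s (δ := 1 / √m) (by positivity)
  rw [hF, hE] at h
  refine h.trans (mul_le_mul_of_nonneg_left ?_ (abs_nonneg s))
  have hB : -(1 / 2) * (1 / (m : ℝ) ^ 2 * S - 2 / m * A + W) ≤ M / m := by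
    rw [← sub_nonneg]
    have : M / m - -(1 / 2) * (1 / (m : ℝ) ^ 2 * S - 2 / m * A + W)
        = 1 / (2 * (m : ℝ) ^ 2) * (2 * M * m + S - 2 * m * A + m ^ 2 * W) := by
      field_simp; ring
    rw [this]
    refine mul_nonneg (by positivity) ?_
    linarith
  calc M * (1 / √m) + 1 / (2 * (1 / √m)) * (-(1 / 2) * (1 / (m : ℝ) ^ 2 * S - 2 / m * A + W))
      ≤ M * (1 / √m) + 1 / (2 * (1 / √m)) * (M / m) := by gcongr
    _ = 3 / 2 * M / √m := by
      rw [show M / (m : ℝ) = M / √m ^ 2 by rw [hsq]]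
      field_simp; ring

end IsCondSupportPoints

/-! ### Averages over a sequence of cells -/

/-- Centring at the conditional mean given the event `U ∈ B`. If the event is null, the conditional
mean is `0` by convention, and the integral vanishes whatever its value. -/
theorem integral_indicator_mul_sub_integral_cond {Ω E : Type*} [MeasurableSpace Ω]
    [MeasurableSpace E] {P : Measure Ω} [IsFiniteMeasure P] {U : Ω → E} (hU : Measurable U)
    {B : Set E} (hB : MeasurableSet B) {h : Ω → ℝ} (hh : Integrable h P) :
    ∫ ω, B.indicator 1 (U ω) * (h ω - ∫ ω, h ω ∂P[|U ⁻¹' B]) ∂P = 0 := by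
  set c := ∫ ω, h ω ∂P[|U ⁻¹' B] with hc
  have hA : MeasurableSet (U ⁻¹' B) := hU hB
  have h1 : ∀ ω, B.indicator (1 : E → ℝ) (U ω) * (h ω - c)
      = (U ⁻¹' B).indicator (fun ω => h ω - c) ω := by
    intro ω
    by_cases hω : U ω ∈ B <;> simp [hω]
  simp_rw [h1]
  rw [integral_indicator hA, integral_sub hh.integrableOn (integrable_const c), hc,
    ProbabilityTheory.cond, integral_smul_measure, setIntegral_const]
  by_cases h0 : P (U ⁻¹' B) = 0
  · simp [Measure.restrict_eq_zero.2 h0, measureReal_def, h0]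
  · have h2 : (P (U ⁻¹' B)).toReal ≠ 0 := ENNReal.toReal_ne_zero.2 ⟨h0, measure_ne_top _ _⟩
    simp [measureReal_def, h2]

/-- Self-normalized Chernoff bound for the data in a cell. Since the bound compensates the sum by
the random number of data in the cell, it needs no information on the probability of the cell. -/
theorem measure_le_cellCount_le {Ω E : Type*} [MeasurableSpace Ω] [MeasurableSpace E]
    {P : Measure Ω} [IsProbabilityMeasure P] {X : ℕ → Ω → E} {Y : ℕ → Ω → ℝ}
    (hX : ∀ i, Measurable (X i)) (hY : ∀ i, Measurable (Y i))
    (hindep : iIndepFun (fun i ω => (X i ω, Y i ω)) P)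
    (hident : ∀ i, IdentDistrib (fun ω => (X i ω, Y i ω)) (fun ω => (X 0 ω, Y 0 ω)) P P)
    {B : Set E} (hB : MeasurableSet B) {g : ℝ → ℝ} (hg : Measurable g) (hg1 : ∀ y, |g y| ≤ 1)
    {ε : ℝ} (hε : 0 < ε) (hε4 : ε ≤ 4) (N : ℕ) (L : ℝ) :
    P {ω | L ≤ cellCount N (fun i => X i ω) B ∧ ε * cellCount N (fun i => X i ω) B
        ≤ ∑ i ∈ Finset.range N, B.indicator 1 (X i ω)
          * (g (Y i ω) - ∫ ω, g (Y 0 ω) ∂P[|X 0 ⁻¹' B])}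
      ≤ ENNReal.ofReal (Real.exp (-(ε ^ 2 / 16 * L))) := by
  set c := ∫ ω, g (Y 0 ω) ∂P[|X 0 ⁻¹' B] with hc
  have hc1 : |c| ≤ 1 := by
    have h := norm_integral_le_of_norm_le_const (μ := P[|X 0 ⁻¹' B]) (C := 1)
      (f := fun ω => g (Y 0 ω)) (ae_of_all _ fun ω => hg1 (Y 0 ω))
    rw [one_mul] at h
    refine h.trans ?_
    by_cases h0 : P (X 0 ⁻¹' B) = 0
    · simp [cond_eq_zero_of_meas_eq_zero h0]
    · have := cond_isProbabilityMeasure h0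
      simp
  -- the exponent that maximizes `l * ε - 4 * l ^ 2`, with the value `ε ^ 2 / 16`
  set l := ε / 8 with hl
  set q := Real.exp (-(4 * l ^ 2)) with hq
  let ξ : E × ℝ → ℝ := fun p => B.indicator 1 p.1 * (g p.2 - c)
  let φ : E × ℝ → ℝ := fun p => B.indicator 1 p.1 * (l * (g p.2 - c) - 4 * l ^ 2)
  have hind : Measurable fun p : E × ℝ => B.indicator (1 : E → ℝ) p.1 :=
    (measurable_one.indicator hB).comp measurable_fst
  have hξm : Measurable ξ := hind.mul ((hg.comp measurable_snd).sub_const c)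
  have hφm : Measurable φ :=
    hind.mul ((((hg.comp measurable_snd).sub_const c).const_mul l).sub_const _)
  have hζ : ∀ y, |g y - c| ≤ 2 := fun y => by linarith [abs_sub (g y) c, hg1 y]
  have hpair : ∀ i, Measurable fun ω => (X i ω, Y i ω) := fun i => (hX i).prodMk (hY i)
  have hξint : ∀ i, Integrable (fun ω => ξ (X i ω, Y i ω)) P := by
    intro i
    refine Integrable.of_bound (hξm.comp (hpair i)).aestronglyMeasurable 2 (ae_of_all _ fun ω => ?_)
    by_cases h : X i ω ∈ B
    · simpa [ξ, h] using hζ (Y i ω)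
    · simp [ξ, h]
  have hmean : ∀ i, ∫ ω, ξ (X i ω, Y i ω) ∂P = 0 := by
    intro i
    have h := ((hident i).comp hξm).integral_eq
    refine h.trans (integral_indicator_mul_sub_integral_cond (hX 0) hB ?_)
    exact Integrable.of_bound (hg.comp (hY 0)).aestronglyMeasurable 1 (ae_of_all _ fun ω => hg1 _)
  -- the bound is affine in the centred variable `ξ`, so that its expectation is `1`
  have hpt : ∀ p, Real.exp (φ p) ≤ 1 + q * l * ξ p := by
    rintro ⟨x, y⟩
    by_cases h : x ∈ B
    · have h1 : |l * (g y - c)| ≤ 2 * l := by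
        rw [abs_mul, abs_of_pos (by positivity)]
        nlinarith [hζ y, (by positivity : 0 < l)]
      have h2 := (abs_le.1 (Real.abs_exp_sub_one_sub_id_le (x := l * (g y - c))
        (h1.trans (by rw [hl]; linarith)))).2
      have h3 : (l * (g y - c)) ^ 2 ≤ 4 * l ^ 2 := by
        rw [← sq_abs]
        exact (pow_le_pow_left₀ (abs_nonneg _) h1 2).trans (le_of_eq (by ring))
      have h4 : q * (1 + 4 * l ^ 2) ≤ 1 := by
        rw [hq, Real.exp_neg, inv_mul_le_iff₀ (Real.exp_pos _), mul_one]
        linarith [Real.add_one_le_exp (4 * l ^ 2)]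
      have h5 : Real.exp (φ (x, y)) = q * Real.exp (l * (g y - c)) := by
        rw [hq, ← Real.exp_add]
        congr 1
        simp [φ, h]; ring
      have h6 : Real.exp (l * (g y - c)) ≤ 1 + 4 * l ^ 2 + l * (g y - c) := by linarith
      have h7 := mul_le_mul_of_nonneg_left h6 (Real.exp_pos (-(4 * l ^ 2))).le
      rw [h5]
      simp only [ξ, Set.indicator_of_mem h, Pi.one_apply, one_mul]
      linarith
    · simp [φ, ξ, h]
  have hmgf : ∀ i, mgf (fun ω => φ (X i ω, Y i ω)) P 1 ≤ 1 := by
    intro i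
    have h : ∫ ω, Real.exp (1 * φ (X i ω, Y i ω)) ∂P ≤ ∫ ω, (1 + q * l * ξ (X i ω, Y i ω)) ∂P := by
      refine integral_mono_of_nonneg (ae_of_all _ fun ω => (Real.exp_pos _).le)
        ((integrable_const 1).add ((hξint i).const_mul _)) (ae_of_all _ fun ω => ?_)
      simpa using hpt (X i ω, Y i ω)
    rw [integral_add (integrable_const 1) ((hξint i).const_mul _), integral_const_mul, hmean] at h
    simpa [mgf] using h
  set T : Ω → ℝ := ∑ i ∈ Finset.range N, fun ω => φ (X i ω, Y i ω) with hT
  have hTm : Measurable T := by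
    rw [hT, Finset.sum_fn]
    exact Finset.measurable_sum _ fun i _ => hφm.comp (hpair i)
  have hTmgf : mgf T P 1 ≤ 1 := by
    refine ((hindep.comp (fun _ => φ) fun _ => hφm).mgf_sum
      (fun i => hφm.comp (hpair i)) _).trans_le ?_
    exact Finset.prod_le_one (fun i _ => mgf_nonneg) fun i _ => hmgf i
  have hTeq : ∀ ω, T ω = l * (∑ i ∈ Finset.range N, B.indicator 1 (X i ω) * (g (Y i ω) - c))
      - 4 * l ^ 2 * cellCount N (fun i => X i ω) B := by
    intro ω
    rw [hT, Finset.sum_apply, cellCount, Nat.cast_sum, Finset.mul_sum, Finset.mul_sum,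
      ← Finset.sum_sub_distrib]
    refine Finset.sum_congr rfl fun i _ => ?_
    by_cases h : X i ω ∈ B <;> simp [φ, h]
  have hTint : Integrable (fun ω => Real.exp (1 * T ω)) P := by
    refine Integrable.of_bound (hTm.const_mul 1).exp.aestronglyMeasurable
      (Real.exp (∑ i ∈ Finset.range N, 2 * l)) (ae_of_all _ fun ω => ?_)
    rw [Real.norm_eq_abs, Real.abs_exp, one_mul, hT, Finset.sum_apply]
    refine Real.exp_le_exp.2 (Finset.sum_le_sum fun i _ => ?_)
    have hl0 : 0 < l := by positivity
    by_cases h : X i ω ∈ B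
    · simp only [φ, Set.indicator_of_mem h, Pi.one_apply, one_mul]
      nlinarith [(abs_le.1 (hζ (Y i ω))).2, sq_nonneg l]
    · simp only [φ, Set.indicator_of_notMem h, zero_mul]; positivity
  have hfin := measure_ge_le_exp_mul_mgf (μ := P) (X := T) (t := 1) (ε ^ 2 / 16 * L)
    zero_le_one hTint
  have hsub : {ω | L ≤ cellCount N (fun i => X i ω) B ∧ ε * cellCount N (fun i => X i ω) B
        ≤ ∑ i ∈ Finset.range N, B.indicator 1 (X i ω) * (g (Y i ω) - c)}
      ⊆ {ω | ε ^ 2 / 16 * L ≤ T ω} := by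
    rintro ω ⟨h1, h2⟩
    rw [Set.mem_ofPred_eq, hTeq]
    have h3 := mul_le_mul_of_nonneg_left h2 (by positivity : 0 ≤ l)
    have h4 := mul_le_mul_of_nonneg_left h1 (by positivity : 0 ≤ ε ^ 2 / 16)
    rw [hl] at h3 ⊢
    linarith
  refine (measure_mono hsub).trans ?_
  rw [← ofReal_measureReal]
  refine ENNReal.ofReal_le_ofReal (hfin.trans ?_)
  rw [neg_one_mul]
  exact mul_le_of_le_one_right (Real.exp_pos _).le hTmgf

/-- One half of the strong law of large numbers along a sequence of cells; the other half is the
same statement for `-g`. -/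
theorem ae_eventually_sum_lt {Ω E : Type*} [MeasurableSpace Ω] [MeasurableSpace E]
    {P : Measure Ω} [IsProbabilityMeasure P] {X : ℕ → Ω → E} {Y : ℕ → Ω → ℝ}
    (hX : ∀ i, Measurable (X i)) (hY : ∀ i, Measurable (Y i))
    (hindep : iIndepFun (fun i ω => (X i ω, Y i ω)) P)
    (hident : ∀ i, IdentDistrib (fun ω => (X i ω, Y i ω)) (fun ω => (X 0 ω, Y 0 ω)) P P)
    {N : ℕ → ℕ} {B : ℕ → Set E} (hB : ∀ n, MeasurableSet (B n))
    (hcount : ∀ᵐ ω ∂P, ∀ C : ℝ, ∀ᶠ n : ℕ in atTop,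
      C * Real.log n ≤ cellCount (N n) (fun i => X i ω) (B n))
    {g : ℝ → ℝ} (hg : Measurable g) (hg1 : ∀ y, |g y| ≤ 1) {ε : ℝ} (hε : 0 < ε) (hε4 : ε ≤ 4) :
    ∀ᵐ ω ∂P, ∀ᶠ n in atTop,
      ∑ i ∈ Finset.range (N n), (B n).indicator 1 (X i ω)
          * (g (Y i ω) - ∫ ω, g (Y 0 ω) ∂P[|X 0 ⁻¹' (B n)])
        < ε * cellCount (N n) (fun i => X i ω) (B n) := by
  -- with this number of data in the cell the exceptional probability is `n ^ (-2)`
  set C := 32 / ε ^ 2 with hC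
  have hsum : Summable fun n : ℕ => Real.exp (-(ε ^ 2 / 16 * (C * Real.log n))) := by
    refine Summable.of_norm_bounded_eventually_nat
      (Real.summable_one_div_nat_pow.2 one_lt_two) ?_
    filter_upwards [eventually_ge_atTop 1] with n hn
    have hn' : (0 : ℝ) < n := by exact_mod_cast hn
    have h : -(ε ^ 2 / 16 * (C * Real.log n)) = -(Real.log ((n : ℝ) ^ 2)) := by
      rw [hC, Real.log_pow]; field_simp; norm_num; ring
    rw [h, Real.exp_neg, Real.exp_log (by positivity), Real.norm_eq_abs,
      abs_of_pos (by positivity), one_div]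
  have h := ae_eventually_notMem (ne_top_of_le_ne_top hsum.tsum_ofReal_ne_top
    (ENNReal.tsum_le_tsum fun n => measure_le_cellCount_le hX hY hindep hident (hB n) hg hg1 hε hε4
      (N n) (C * Real.log n)))
  filter_upwards [h, hcount] with ω h1 h2
  filter_upwards [h1, h2 C] with n h3 h4
  by_contra h5
  exact h3 ⟨h4, not_lt.1 h5⟩

/-- Strong law of large numbers along a sequence of cells that receive more data than any multiple
of `log n`. -/
theorem ae_tendsto_average_sub {Ω E : Type*} [MeasurableSpace Ω] [MeasurableSpace E]
    {P : Measure Ω} [IsProbabilityMeasure P] {X : ℕ → Ω → E} {Y : ℕ → Ω → ℝ}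
    (hX : ∀ i, Measurable (X i)) (hY : ∀ i, Measurable (Y i))
    (hindep : iIndepFun (fun i ω => (X i ω, Y i ω)) P)
    (hident : ∀ i, IdentDistrib (fun ω => (X i ω, Y i ω)) (fun ω => (X 0 ω, Y 0 ω)) P P)
    {N : ℕ → ℕ} {B : ℕ → Set E} (hB : ∀ n, MeasurableSet (B n))
    (hcount : ∀ᵐ ω ∂P, ∀ C : ℝ, ∀ᶠ n : ℕ in atTop,
      C * Real.log n ≤ cellCount (N n) (fun i => X i ω) (B n))
    {g : ℝ → ℝ} (hg : Measurable g) (hg1 : ∀ y, |g y| ≤ 1) :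
    ∀ᵐ ω ∂P, Tendsto (fun n => 1 / (cellCount (N n) (fun i => X i ω) (B n) : ℝ)
        * (∑ i ∈ Finset.range (N n), (B n).indicator 1 (X i ω) * g (Y i ω))
        - ∫ ω, g (Y 0 ω) ∂P[|X 0 ⁻¹' (B n)]) atTop (𝓝 0) := by
  have hpos : ∀ k : ℕ, (0 : ℝ) < 1 / (k + 1) := fun k => by positivity
  have hle : ∀ k : ℕ, (1 : ℝ) / (k + 1) ≤ 4 := fun k => by
    rw [div_le_iff₀ (by positivity)]
    linarith [(Nat.cast_nonneg k : (0 : ℝ) ≤ k)]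
  have h1 := ae_all_iff.2 fun k : ℕ =>
    ae_eventually_sum_lt hX hY hindep hident hB hcount hg hg1 (hpos k) (hle k)
  have h2 := ae_all_iff.2 fun k : ℕ =>
    ae_eventually_sum_lt hX hY hindep hident hB hcount hg.neg (fun y => by simpa using hg1 y)
      (hpos k) (hle k)
  filter_upwards [h1, h2] with ω h1 h2
  rw [Metric.tendsto_nhds]
  intro ε hε
  obtain ⟨k, hk⟩ := exists_nat_one_div_lt hε
  filter_upwards [h1 k, h2 k] with n h3 h4
  set c := ∫ ω, g (Y 0 ω) ∂P[|X 0 ⁻¹' (B n)]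
  set D := (cellCount (N n) (fun i => X i ω) (B n) : ℝ) with hD
  have hsplit : ∀ (u : ℕ → ℝ) (b : ℝ), ∑ i ∈ Finset.range (N n),
      (B n).indicator 1 (X i ω) * (u i - b)
      = ∑ i ∈ Finset.range (N n), (B n).indicator 1 (X i ω) * u i - D * b := by
    intro u b
    have : D = ∑ i ∈ Finset.range (N n), (B n).indicator 1 (X i ω) := by
      rw [hD, cellCount, Nat.cast_sum]
      exact Finset.sum_congr rfl fun i _ => by by_cases h : X i ω ∈ B n <;> simp [h]
    rw [this, Finset.sum_mul, ← Finset.sum_sub_distrib]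
    exact Finset.sum_congr rfl fun i _ => by ring
  simp only [Pi.neg_apply, integral_neg] at h4
  rw [hsplit] at h3 h4
  simp only [mul_neg, Finset.sum_neg_distrib] at h4
  have hDpos : 0 < D := by
    have : 0 < 1 / ((k : ℝ) + 1) * D := by linarith
    exact pos_of_mul_pos_right this (hpos k).le
  rw [Real.dist_eq, sub_zero, abs_lt]
  set S := ∑ i ∈ Finset.range (N n), (B n).indicator 1 (X i ω) * g (Y i ω)
  have hS : D * (1 / D * S - c) = S - D * c := by field_simp
  constructor
  · refine lt_of_mul_lt_mul_left ?_ hDpos.le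
    rw [hS]; nlinarith
  · refine lt_of_mul_lt_mul_left ?_ hDpos.le
    rw [hS]; nlinarith

/-! ### Characteristic functions of cells -/

theorem ae_tendsto_cellCharFun_sub_condCharFun {Ω E : Type*} [MeasurableSpace Ω]
    [MeasurableSpace E] {P : Measure Ω} [IsProbabilityMeasure P] {X : ℕ → Ω → E} {Y : ℕ → Ω → ℝ}
    (hX : ∀ i, Measurable (X i)) (hY : ∀ i, Measurable (Y i))
    (hindep : iIndepFun (fun i ω => (X i ω, Y i ω)) P)
    (hident : ∀ i, IdentDistrib (fun ω => (X i ω, Y i ω)) (fun ω => (X 0 ω, Y 0 ω)) P P)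
    {N : ℕ → ℕ} {B : ℕ → Set E} (hB : ∀ n, MeasurableSet (B n))
    (hcount : ∀ᵐ ω ∂P, ∀ C : ℝ, ∀ᶠ n : ℕ in atTop,
      C * Real.log n ≤ cellCount (N n) (fun i => X i ω) (B n)) (s : ℝ) :
    ∀ᵐ ω ∂P, Tendsto (fun n => cellCharFun (N n) (fun i => X i ω) (fun i => Y i ω) (B n) s
      - condCharFun P (X 0) (Y 0) (B n) s) atTop (𝓝 0) := by
  have hcos : Measurable fun y : ℝ => Real.cos (s * y) := by fun_prop
  have hsin : Measurable fun y : ℝ => Real.sin (s * y) := by fun_prop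
  have h1 := ae_tendsto_average_sub hX hY hindep hident hB hcount hcos
    (fun y => Real.abs_cos_le_one _)
  have h2 := ae_tendsto_average_sub hX hY hindep hident hB hcount hsin
    (fun y => Real.abs_sin_le_one _)
  have hexp : ∀ y : ℝ, Complex.exp (Complex.I * s * y)
      = (Real.cos (s * y) : ℂ) + (Real.sin (s * y) : ℂ) * Complex.I := by
    intro y
    rw [mul_assoc, mul_comm, Complex.exp_mul_I]
    push_cast; rfl
  have hcond : ∀ n, condCharFun P (X 0) (Y 0) (B n) s
      = ((∫ ω, Real.cos (s * Y 0 ω) ∂P[|X 0 ⁻¹' (B n)] : ℝ) : ℂ)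
        + ((∫ ω, Real.sin (s * Y 0 ω) ∂P[|X 0 ⁻¹' (B n)] : ℝ) : ℂ) * Complex.I := by
    intro n
    have hb : ∀ {u : ℝ → ℝ}, Measurable u → (∀ y, |u y| ≤ 1) →
        Integrable (fun ω => ((u (Y 0 ω) : ℝ) : ℂ)) P[|X 0 ⁻¹' (B n)] := fun hu hu1 =>
      Integrable.of_bound
        (Complex.measurable_ofReal.comp (hu.comp (hY 0))).aestronglyMeasurable 1
        (ae_of_all _ fun ω => by simpa using hu1 _)
    rw [condCharFun, charFun_apply_real, integral_map (hY 0).aemeasurable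
      (by fun_prop : Continuous fun x : ℝ => Complex.exp (s * x * Complex.I)).aestronglyMeasurable,
      ← integral_complex_ofReal, ← integral_complex_ofReal, ← integral_mul_const, ← integral_add
        (hb hcos fun y => Real.abs_cos_le_one _)
        ((hb hsin fun y => Real.abs_sin_le_one _).mul_const _)]
    refine integral_congr_ae (ae_of_all _ fun ω => ?_)
    simp only [← hexp]
    congr 1; ring
  filter_upwards [h1, h2] with ω h1 h2
  have h3 := ((Complex.continuous_ofReal.tendsto 0).comp h1).add
    (((Complex.continuous_ofReal.tendsto 0).comp h2).mul_const Complex.I)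
  simp only [Complex.ofReal_zero, zero_mul, add_zero] at h3
  refine h3.congr fun n => ?_
  have hi : ∀ i, (((B n).indicator 1 (X i ω) : ℝ) : ℂ) = (B n).indicator 1 (X i ω) := by
    intro i
    by_cases h : X i ω ∈ B n <;> simp [h]
  simp only [Function.comp_apply, hcond, cellCharFun, hexp, Complex.ofReal_sub, Complex.ofReal_mul,
    Complex.ofReal_sum, Complex.ofReal_div, Complex.ofReal_one, Complex.ofReal_natCast, hi,
    mul_add, Finset.sum_add_distrib, ← mul_assoc]
  rw [← Finset.sum_mul]
  ring

theorem norm_cexp_sub_cexp_le (s t y : ℝ) :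
    ‖Complex.exp (Complex.I * s * y) - Complex.exp (Complex.I * t * y)‖ ≤ |s - t| * |y| := by
  have h : Complex.exp (Complex.I * s * y) - Complex.exp (Complex.I * t * y)
      = Complex.exp (Complex.I * (t * y : ℝ))
        * (Complex.exp (Complex.I * ((s - t) * y : ℝ)) - 1) := by
    rw [mul_sub, ← Complex.exp_add, mul_one]
    push_cast
    congr 2 <;> ring
  rw [h, norm_mul, Complex.norm_exp_I_mul_ofReal, one_mul, ← abs_mul]
  exact Real.norm_exp_I_mul_ofReal_sub_one_le

theorem norm_cellCharFun_sub_le {E : Type*} {N : ℕ} {x : ℕ → E} {y : ℕ → ℝ} {B : Set E} {M : ℝ}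
    (hM : ∀ i, |y i| ≤ M) (s t : ℝ) :
    ‖cellCharFun N x y B s - cellCharFun N x y B t‖ ≤ |s - t| * M := by
  have hM0 : 0 ≤ M := (abs_nonneg _).trans (hM 0)
  rw [cellCharFun, cellCharFun, ← mul_sub, ← Finset.sum_sub_distrib, norm_mul]
  have h : ‖∑ i ∈ Finset.range N, (B.indicator 1 (x i) * Complex.exp (Complex.I * s * y i)
      - B.indicator 1 (x i) * Complex.exp (Complex.I * t * y i))‖
      ≤ cellCount N x B * (|s - t| * M) := by
    rw [cellCount, Nat.cast_sum, Finset.sum_mul]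
    refine (norm_sum_le _ _).trans (Finset.sum_le_sum fun i _ => ?_)
    by_cases h : x i ∈ B
    · simp only [Set.indicator_of_mem h, Pi.one_apply, one_mul, Nat.cast_one]
      exact (norm_cexp_sub_cexp_le s t (y i)).trans (by gcongr; exact hM i)
    · simp [h]
  refine (mul_le_mul_of_nonneg_left h (norm_nonneg _)).trans ?_
  by_cases hc : (cellCount N x B : ℝ) = 0
  · rw [hc]; simp; positivity
  · rw [norm_div, norm_one, Complex.norm_natCast, ← mul_assoc, one_div, inv_mul_cancel₀ hc, one_mul]

theorem norm_condCharFun_sub_le {Ω E : Type*} [MeasurableSpace Ω] {P : Measure Ω}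
    [IsProbabilityMeasure P] {U : Ω → E} {V : Ω → ℝ} (hV : Measurable V) {B : Set E} {M : ℝ}
    (hM0 : 0 ≤ M) (hM : ∀ᵐ ω ∂P, |V ω| ≤ M) (s t : ℝ) :
    ‖condCharFun P U V B s - condCharFun P U V B t‖ ≤ |s - t| * M := by
  have hrew : ∀ s : ℝ, condCharFun P U V B s
      = ∫ ω, Complex.exp (Complex.I * s * V ω) ∂P[|U ⁻¹' B] := by
    intro s
    rw [condCharFun, charFun_apply_real, integral_map hV.aemeasurable
      (by fun_prop : Continuous fun x : ℝ => Complex.exp (s * x * Complex.I)).aestronglyMeasurable]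
    refine integral_congr_ae (ae_of_all _ fun ω => ?_)
    show Complex.exp _ = Complex.exp _
    congr 1; ring
  have hint : ∀ s : ℝ, Integrable (fun ω => Complex.exp (Complex.I * s * V ω)) P[|U ⁻¹' B] := by
    intro s
    refine Integrable.of_bound (by fun_prop) 1 (ae_of_all _ fun ω => ?_)
    rw [mul_assoc, ← Complex.ofReal_mul, Complex.norm_exp_I_mul_ofReal]
  rw [hrew, hrew, ← integral_sub (hint s) (hint t)]
  have hb : ∀ᵐ ω ∂P[|U ⁻¹' B],
      ‖Complex.exp (Complex.I * s * V ω) - Complex.exp (Complex.I * t * V ω)‖ ≤ |s - t| * M := by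
    filter_upwards [cond_absolutelyContinuous.ae_le hM] with ω hω
    exact (norm_cexp_sub_cexp_le s t (V ω)).trans (by gcongr)
  refine (norm_integral_le_of_norm_le_const hb).trans (mul_le_of_le_one_right (by positivity) ?_)
  by_cases h0 : P (U ⁻¹' B) = 0
  · simp [cond_eq_zero_of_meas_eq_zero h0]
  · have := cond_isProbabilityMeasure h0
    simp

/-! ### Cells of a binning partition -/

theorem GridPartition.measurableSet_cell {d : ℕ} {𝒳 : Set (EuclideanSpace ℝ (Fin d))} {κ : ℕ}
    (h𝒳 : MeasurableSet 𝒳) (G : GridPartition 𝒳 κ) (k : Fin d → Fin κ) :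
    MeasurableSet (G.cell k) := by
  have h : G.cell k
      = 𝒳 ∩ ⋂ q, (fun x : EuclideanSpace ℝ (Fin d) => x q) ⁻¹' G.interval q (k q) := by
    ext x; simp [GridPartition.cell]
  rw [h]
  refine h𝒳.inter (MeasurableSet.iInter fun q => ?_)
  exact (by fun_prop : Measurable fun x : EuclideanSpace ℝ (Fin d) => x q)
    (G.ordConnected q (k q)).measurableSet

/-- If `n log n = O(N n)` and the proportional share `b n` of `a n` out of `N n` tends to infinity,
then `a n` exceeds every multiple of `log n`. -/
theorem eventually_mul_log_le_of_proportional {N a b : ℕ → ℕ}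
    (hN : (fun n : ℕ => (n : ℝ) * Real.log n) =O[atTop] fun n => (N n : ℝ))
    (hb : ∀ n : ℕ, |(b n : ℝ) - n * (a n : ℝ) / (N n : ℝ)| ≤ 1)
    (hb_top : Tendsto b atTop atTop) (C : ℝ) :
    ∀ᶠ n : ℕ in atTop, C * Real.log n ≤ a n := by
  obtain ⟨c, hc, hcN⟩ := hN.exists_pos
  filter_upwards [hcN.bound, eventually_ge_atTop 2,
    (tendsto_natCast_atTop_atTop.comp hb_top).eventually_ge_atTop (C * c + 1)] with n h1 h2 h3
  have hn : (2 : ℝ) ≤ n := by exact_mod_cast h2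
  have hlog : 0 < Real.log n := Real.log_pos (by linarith)
  rw [Real.norm_of_nonneg (by positivity), Real.norm_of_nonneg (by positivity)] at h1
  have hNpos : (0 : ℝ) < N n := by
    have : 0 < c * (N n : ℝ) := lt_of_lt_of_le (by positivity) h1
    exact pos_of_mul_pos_right this hc.le
  simp only [Function.comp_apply] at h3
  have h4 : C * c ≤ n * (a n : ℝ) / N n := by linarith [(abs_le.1 (hb n)).2]
  rw [le_div_iff₀ hNpos] at h4
  rcases le_or_gt C 0 with hC | hC
  · exact (mul_nonpos_of_nonpos_of_nonneg hC hlog.le).trans (Nat.cast_nonneg _)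
  · have h5 := mul_le_mul_of_nonneg_left h1 hC.le
    refine le_of_mul_le_mul_left ?_ (by linarith : (0 : ℝ) < n)
    linarith

theorem mainTheorem4
    {Ω : Type*} [MeasurableSpace Ω] (P : Measure Ω) [IsProbabilityMeasure P]
    {d : ℕ}
    -- the covariate space has finite Lebesgue measure, the response space is bounded
    (𝒳 : Set (EuclideanSpace ℝ (Fin d))) (h𝒳 : MeasurableSet 𝒳) (h𝒳fin : volume 𝒳 < ⊤)
    (𝒴 : Set ℝ) (h𝒴 : MeasurableSet 𝒴) (h𝒴bdd : Bornology.IsBounded 𝒴)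
    -- independent and identically distributed observations
    (X : ℕ → Ω → EuclideanSpace ℝ (Fin d)) (Y : ℕ → Ω → ℝ)
    (hX : ∀ i, Measurable (X i)) (hY : ∀ i, Measurable (Y i))
    (hindep : iIndepFun (fun i ω => (X i ω, Y i ω)) P)
    (hident : ∀ i, IdentDistrib (fun ω => (X i ω, Y i ω)) (fun ω => (X 0 ω, Y 0 ω)) P P)
    (hX𝒳 : ∀ᵐ ω ∂P, X 0 ω ∈ 𝒳) (hY𝒴 : ∀ᵐ ω ∂P, Y 0 ω ∈ 𝒴)
    -- the conditional density, uniformly continuous in the covariate for almost every response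
    (f : EuclideanSpace ℝ (Fin d) → ℝ → ℝ) (hf : IsCondDensity P (X 0) (Y 0) f)
    (hfuc : ∀ᵐ y ∂(volume.restrict 𝒴), UniformContinuousOn (fun x => f x y) 𝒳)
    -- the size `N n` of the full data set that is reduced to about `n` points
    (N : ℕ → ℕ) (hN : (fun n : ℕ => (n : ℝ) * Real.log n) =O[atTop] fun n => (N n : ℝ))
    -- the partitions; their number of cells tends to infinity
    (κ : ℕ → ℕ) (G : ∀ n, GridPartition 𝒳 (κ n))
    (hK : Tendsto (fun n => κ n ^ d) atTop atTop)
    -- numbers of points in the cells, proportional to the numbers of observations up to rounding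
    (m : ∀ n, Ω → (Fin d → Fin (κ n)) → ℕ)
    (hm : ∀ n ω k, |(m n ω k : ℝ)
      - n * (cellCount (N n) (fun i => X i ω) ((G n).cell k) : ℝ) / (N n : ℝ)| ≤ 1)
    (hm_top : ∀ x : 𝒳, ∀ᵐ ω ∂P, Tendsto (fun n => m n ω ((G n).index x)) atTop atTop)
    -- the conditional support points in each cell
    (z : ∀ n ω k, Fin (m n ω k) → ℝ)
    (hz : ∀ n ω k,
      IsCondSupportPoints (N n) (fun i => X i ω) (fun i => Y i ω) ((G n).cell k) (z n ω k)) :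
    ∀ x : 𝒳, ∀ᵐ ω ∂P, ∀ s : ℝ,
      Tendsto (fun n => empiricalCharFun (z n ω ((G n).index x)) s
        - condCharFun P (X 0) (Y 0) ((G n).cell ((G n).index x)) s) atTop (𝓝 0) := by
  intro x
  obtain ⟨M, hM0, hM⟩ := h𝒴bdd.exists_pos_norm_le
  set B : ℕ → Set (EuclideanSpace ℝ (Fin d)) := fun n => (G n).cell ((G n).index x) with hBdef
  have hB : ∀ n, MeasurableSet (B n) := fun n => (G n).measurableSet_cell h𝒳 _
  have hYM : ∀ᵐ ω ∂P, ∀ i, |Y i ω| ≤ M := by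
    refine ae_all_iff.2 fun i => ?_
    have h := ((hident i).symm.comp measurable_snd).ae_mem_snd h𝒴 hY𝒴
    filter_upwards [h] with ω hω using hM _ hω
  have hcount : ∀ᵐ ω ∂P, ∀ C : ℝ, ∀ᶠ n : ℕ in atTop,
      C * Real.log n ≤ cellCount (N n) (fun i => X i ω) (B n) := by
    filter_upwards [hm_top x] with ω hω C
    exact eventually_mul_log_le_of_proportional hN (fun n => hm n ω _) hω C
  have hdata := ae_all_iff.2 fun r : ℚ =>
    ae_tendsto_cellCharFun_sub_condCharFun hX hY hindep hident hB hcount (r : ℝ)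
  filter_upwards [hYM, hcount, hdata, hm_top x] with ω hYω hcω hdω hmω s
  have hsupp : Tendsto (fun n => empiricalCharFun (z n ω ((G n).index x)) s
      - cellCharFun (N n) (fun i => X i ω) (fun i => Y i ω) (B n) s) atTop (𝓝 0) := by
    have hlim : Tendsto (fun n => |s| * (3 / 2 * M / √(m n ω ((G n).index x) : ℝ)))
        atTop (𝓝 0) := by
      have h := (Real.tendsto_sqrt_atTop.comp
        (tendsto_natCast_atTop_atTop.comp hmω)).const_div_atTop (3 / 2 * M)
      simpa using h.const_mul |s|
    refine squeeze_zero_norm' ?_ hlim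
    filter_upwards [hcω 1, eventually_ge_atTop 2, hmω.eventually_gt_atTop 0] with n h1 h2 h3
    have hn : (1 : ℝ) < n := by exact_mod_cast h2
    have hpos : 0 < cellCount (N n) (fun i => X i ω) (B n) := by
      have : (0 : ℝ) < cellCount (N n) (fun i => X i ω) (B n) := by linarith [Real.log_pos hn]
      exact_mod_cast this
    exact (hz n ω _).norm_empiricalCharFun_sub_le (fun i _ _ => hYω i) h3 hpos s
  have hdata_s : Tendsto (fun n => cellCharFun (N n) (fun i => X i ω) (fun i => Y i ω) (B n) s
      - condCharFun P (X 0) (Y 0) (B n) s) atTop (𝓝 0) := by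
    -- a rational frequency near `s` suffices, as both functions are `M`-Lipschitz
    rw [Metric.tendsto_nhds]
    intro ε hε
    obtain ⟨r, hr1, hr2⟩ := exists_rat_btwn (show s < s + ε / (4 * M) by
      linarith [(by positivity : 0 < ε / (4 * M))])
    filter_upwards [(Metric.tendsto_nhds.1 (hdω r)) (ε / 2) (by positivity)] with n hn
    have hsr : |s - r| * M ≤ ε / 4 := by
      rw [abs_of_neg (by linarith)]
      calc -(s - r) * M ≤ ε / (4 * M) * M := by
            refine mul_le_mul_of_nonneg_right (by linarith) hM0.le
        _ = ε / 4 := by field_simp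
    have h1 := norm_cellCharFun_sub_le (N := N n) (x := fun i => X i ω) (B := B n) hYω s r
    have h2 := norm_condCharFun_sub_le (P := P) (U := X 0) (B := B n) (hY 0) hM0.le
      (hYM.mono fun ω h => h 0) s r
    rw [dist_zero_right] at hn ⊢
    set u := cellCharFun (N n) (fun i => X i ω) (fun i => Y i ω) (B n)
    set v := condCharFun P (X 0) (Y 0) (B n)
    calc ‖u s - v s‖ = ‖(u s - u r) + (u r - v r) - (v s - v r)‖ := by congr 1; ring
      _ ≤ ‖u s - u r‖ + ‖u r - v r‖ + ‖v s - v r‖ :=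
        (norm_sub_le _ _).trans (by gcongr; exact norm_add_le _ _)
      _ < ε := by linarith
  simpa using hsupp.add hdata_s
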